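/- Let $\xi_1,\xi_2,\dots$ be independent fair coin tosses, $\mathbb P(\xi_i=1)=\mathbb P(\xi_i=-1)=\tfrac12$, where $\xi_i=1$ stands for Heads and $\xi_i=-1$ for Tails. Let $H_N$ and $T_N$ be the numbers of Heads and of Tails among the first $N$ tosses $\xi_1,\dots,\xi_N$. For $n\ge 0$ let $$X_n=\min\{N\ge 0: H_N=n\text{ or }T_N=n\},\qquad Y_n=\min\{N\ge 0: H_N\ge n\text{ and }T_N\ge n\},$$ which are almost surely finite, be the numbers of tosses until reaching $n$ Heads OR $n$ Tails, respectively $n$ Heads AND $n$ Tails. Let $W$ and $Z$ be independent standard normal $N(0,1)$ random variables. Then, as $n\to\infty$, $$\frac{(Y_n-2n)-(2n-X_n)}{n^{1/4}}=\frac{X_n+Y_n-4n}{n^{1/4}}\ \xrightarrow{\ d\ }\ 2^{3/4}\,|Z|^{1/2}\,W,$$ where $\xrightarrow{\ d\ }$ denotes convergence in distribution. -/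

import Mathlib

open MeasureTheory ProbabilityTheory Filter

noncomputable section

namespace CoinToss

variable {Ω : Type*}

/-- `ξ 1, ξ 2, …` are independent fair coin tosses on `(Ω, P)`, with `1` for Heads and `-1` for
Tails. -/
structure IsFairTosses [MeasurableSpace Ω] (ξ : ℕ → Ω → ℤ) (P : Measure Ω) : Prop where
  measurable : ∀ i, Measurable (ξ i)
  indep : iIndepFun ξ P
  prob_heads : ∀ i, P {ω | ξ i ω = 1} = 1 / 2
  prob_tails : ∀ i, P {ω | ξ i ω = -1} = 1 / 2

/-- `H_N`: the number of Heads among the tosses `1, …, N`. -/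
def heads (ξ : ℕ → Ω → ℤ) (N : ℕ) (ω : Ω) : ℕ :=
  ((Finset.Icc 1 N).filter (fun i => ξ i ω = 1)).card

/-- `T_N`: the number of Tails among the tosses `1, …, N`. -/
def tails (ξ : ℕ → Ω → ℤ) (N : ℕ) (ω : Ω) : ℕ :=
  ((Finset.Icc 1 N).filter (fun i => ξ i ω = -1)).card

/-- `X_n`: the number of tosses until `n` Heads OR `n` Tails are reached. The set is nonempty
almost surely (`sInf ∅ = 0` is used on the exceptional null set). -/
def orDuration (ξ : ℕ → Ω → ℤ) (n : ℕ) (ω : Ω) : ℕ :=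
  sInf {N : ℕ | heads ξ N ω = n ∨ tails ξ N ω = n}

/-- `Y_n`: the number of tosses until `n` Heads AND `n` Tails are reached. The set is nonempty
almost surely (`sInf ∅ = 0` is used on the exceptional null set). -/
def andDuration (ξ : ℕ → Ω → ℤ) (n : ℕ) (ω : Ω) : ℕ :=
  sInf {N : ℕ | n ≤ heads ξ N ω ∧ n ≤ tails ξ N ω}

end CoinToss

end

/-! The proof rests on an exact identity. For arbitrary targets of `a` Heads and `b` Tails and `|z|
= 1`, the generating function `E z^(X+Y)` equals `z^(2(a+b)) E q^D`, where `D` is the distance from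
the number of Heads in `a + b` tosses to `a`, and `q = 2/(z(2-z)) - 1` (`integral_weight`).
Conditioning on the first toss gives both sides the same recursion in `(a, b)`, and `q` is the value
that makes them agree when a target is `0`.

Take `a = b = n` and `z = e^(is)` with `s = t/n^(1/4)`. The factor `z^(4n)` is exactly the centring,
so the characteristic function of the normalised sum is `E q^D` (`charFun_duration`). Since `q = 1 -
2s² + o(s²)` and `E D ≤ √n`, replacing `q` by `e^(-2s²)` costs `√n · o(s²) = o(1)`
(`tendsto_integral_pow_multiplier_sub`). What remains is `E e^(-2s²D)`, as if `X + Y - 4n` were,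
given `D`, centred normal with variance `4D`.

By the central limit theorem `D` is about `√(n/2) |Z|`, so the limit is `E exp(-√2 t² |Z|)`
(`tendsto_integral_exp_pow_excess`). This is the characteristic function of `2^(3/4) |Z|^(1/2) W`,
computed by integrating over `W` first (`charFun_limit`). Lévy's continuity theorem concludes. -/

namespace CoinToss

open scoped ENNReal Topology

/-! ### Canonical fair tosses and first-step conditioning -/

/-- The law of one fair toss, with `true` for Heads. -/
noncomputable def coin : Measure Bool :=
  (1 / 2 : ℝ≥0∞) • Measure.dirac true + (1 / 2 : ℝ≥0∞) • Measure.dirac false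

instance : IsProbabilityMeasure coin := ⟨by simp [coin, ENNReal.inv_two_add_inv_two]⟩

/-- The law of a sequence of independent fair tosses. -/
noncomputable def coinSeq : Measure (ℕ → Bool) := Measure.infinitePi fun _ => coin

instance : IsProbabilityMeasure coinSeq := by unfold coinSeq; infer_instance

/-- Prepend a toss to a sequence of tosses. -/
def consSeq (b : Bool) (x : ℕ → Bool) : ℕ → Bool
  | 0 => b
  | n + 1 => x n

@[simp] lemma consSeq_zero (b : Bool) (x : ℕ → Bool) : consSeq b x 0 = b := rfl

@[simp] lemma consSeq_succ (b : Bool) (x : ℕ → Bool) (n : ℕ) : consSeq b x (n + 1) = x n := rfl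

@[fun_prop] lemma measurable_consSeq (b : Bool) : Measurable (consSeq b) := by
  refine measurable_pi_iff.2 fun n => ?_
  cases n with
  | zero => exact measurable_const
  | succ n => exact measurable_pi_apply n

lemma coin_apply (s : Set Bool) :
    coin s = 1 / 2 * s.indicator 1 true + 1 / 2 * s.indicator 1 false := by
  simp [coin]

/-- A product measure is determined by finite boxes. On a box, coordinate `0` contributes its own
factor, and the remaining constraints, shifted down by one index, form a box again. -/
lemma coinSeq_eq : coinSeq = (1 / 2 : ℝ≥0∞) • coinSeq.map (consSeq true) +
    (1 / 2 : ℝ≥0∞) • coinSeq.map (consSeq false) := by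
  refine (Measure.eq_infinitePi _ fun s t ht => ?_).symm
  have hs : MeasurableSet (Set.pi (s : Set ℕ) t) := .pi s.countable_toSet fun i _ => ht i
  have key (b : Bool) : coinSeq (consSeq b ⁻¹' Set.pi s t) =
      (if 0 ∈ s then (t 0).indicator 1 b else 1) *
        ∏ i ∈ s.erase 0, coin (t i) := by
    classical
    have h1 : ∏ i ∈ s.erase 0, coin (t i) =
        ∏ i ∈ (s.erase 0).image Nat.pred, coin (t (i + 1)) := by
      rw [Finset.prod_image]
      · refine Finset.prod_congr rfl fun i hi => ?_
        rw [Nat.pred_eq_sub_one, Nat.sub_add_cancel (Nat.one_le_iff_ne_zero.2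
          (Finset.ne_of_mem_erase hi))]
      · intro i hi j hj hij
        have := Finset.ne_of_mem_erase (Finset.mem_coe.1 hi)
        have := Finset.ne_of_mem_erase (Finset.mem_coe.1 hj)
        simp only [Nat.pred_eq_sub_one] at hij
        omega
    have h2 : coinSeq (Set.pi ((s.erase 0).image Nat.pred : Finset ℕ) fun i => t (i + 1)) =
        ∏ i ∈ (s.erase 0).image Nat.pred, coin (t (i + 1)) :=
      Measure.infinitePi_pi _ fun i _ => ht (i + 1)
    have h3 : consSeq b ⁻¹' Set.pi s t = {x | (0 ∈ s → b ∈ t 0) ∧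
        x ∈ Set.pi ((s.erase 0).image Nat.pred : Finset ℕ) fun i => t (i + 1)} := by
      ext x
      simp only [Set.mem_preimage, Set.mem_pi, SetLike.mem_coe, Set.mem_ofPred_eq,
        Finset.mem_image, Finset.mem_erase]
      constructor
      · refine fun h => ⟨h 0, ?_⟩
        rintro i ⟨j, ⟨hj0, hj⟩, rfl⟩
        obtain ⟨k, rfl⟩ := Nat.exists_eq_succ_of_ne_zero hj0
        exact h _ hj
      · rintro ⟨h0, h⟩ i hi
        cases i with
        | zero => exact h0 hi
        | succ i => exact h i ⟨i + 1, ⟨by simp, hi⟩, rfl⟩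
    rw [h1, ← h2, h3]
    generalize Set.pi (((s.erase 0).image Nat.pred : Finset ℕ) : Set ℕ)
      (fun i => t (i + 1)) = A
    by_cases h0 : 0 ∈ s
    · by_cases hb : b ∈ t 0 <;> simp [h0, hb]
    · simp [h0]
  rw [Measure.add_apply, Measure.smul_apply, Measure.smul_apply,
    Measure.map_apply (by fun_prop) hs, Measure.map_apply (by fun_prop) hs, key, key]
  by_cases h0 : 0 ∈ s
  · rw [← Finset.mul_prod_erase s _ h0, coin_apply]
    simp only [h0, if_true, smul_eq_mul]
    ring
  · simp only [h0, if_false, smul_eq_mul, one_mul, Finset.erase_eq_of_notMem h0, ← add_mul]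
    simp [ENNReal.inv_two_add_inv_two]

/-- Conditioning on the first toss. -/
lemma integral_coinSeq {𝕜 : Type*} [RCLike 𝕜] {f : (ℕ → Bool) → 𝕜} (hf : Measurable f)
    {C : ℝ} (hC : ∀ x, ‖f x‖ ≤ C) :
    ∫ x, f x ∂coinSeq =
      (∫ x, f (consSeq true x) ∂coinSeq + ∫ x, f (consSeq false x) ∂coinSeq) / 2 := by
  have hi (μ : Measure (ℕ → Bool)) [IsFiniteMeasure μ] : Integrable f μ :=
    .of_bound hf.aestronglyMeasurable C (.of_forall hC)
  have h2 : (1 / 2 : ℝ≥0∞) ≠ ∞ := by simp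
  conv_lhs => rw [coinSeq_eq]
  rw [integral_add_measure ((hi _).smul_measure h2) ((hi _).smul_measure h2),
    integral_smul_measure, integral_smul_measure,
    integral_map (by fun_prop) hf.aestronglyMeasurable,
    integral_map (by fun_prop) hf.aestronglyMeasurable]
  simp [RCLike.real_smul_eq_coe_mul, RCLike.ofReal_ofNat]
  ring

/-! ### Counts of Heads and Tails; measurability of hitting times -/

/-- The number of Heads among the first `N` tosses of `x`. -/
def hd (x : ℕ → Bool) (N : ℕ) : ℕ := ∑ i ∈ Finset.range N, if x i = true then 1 else 0

/-- The number of Tails among the first `N` tosses of `x`. -/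
def tl (x : ℕ → Bool) (N : ℕ) : ℕ := ∑ i ∈ Finset.range N, if x i = false then 1 else 0

@[simp] lemma hd_zero (x : ℕ → Bool) : hd x 0 = 0 := rfl

@[simp] lemma tl_zero (x : ℕ → Bool) : tl x 0 = 0 := rfl

@[simp] lemma hd_cons_true (x : ℕ → Bool) (N : ℕ) :
    hd (consSeq true x) (N + 1) = hd x N + 1 := by
  simp only [hd, Finset.sum_range_succ', consSeq_succ, consSeq_zero]
  rfl

@[simp] lemma hd_cons_false (x : ℕ → Bool) (N : ℕ) :
    hd (consSeq false x) (N + 1) = hd x N := by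
  simp only [hd, Finset.sum_range_succ', consSeq_succ, consSeq_zero]
  rfl

@[simp] lemma tl_cons_true (x : ℕ → Bool) (N : ℕ) :
    tl (consSeq true x) (N + 1) = tl x N := by
  simp only [tl, Finset.sum_range_succ', consSeq_succ, consSeq_zero]
  rfl

@[simp] lemma tl_cons_false (x : ℕ → Bool) (N : ℕ) :
    tl (consSeq false x) (N + 1) = tl x N + 1 := by
  simp only [tl, Finset.sum_range_succ', consSeq_succ, consSeq_zero]
  rfl

lemma hd_le (x : ℕ → Bool) (N : ℕ) : hd x N ≤ N := by
  induction N with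
  | zero => simp
  | succ N ih =>
    rw [hd, Finset.sum_range_succ, ← hd]
    split_ifs <;> omega

@[fun_prop] lemma measurable_hd (N : ℕ) : Measurable fun x => hd x N := by
  refine Finset.measurable_fun_sum _ fun i _ => ?_
  exact (measurable_of_finite fun b : Bool => if b = true then 1 else 0).comp
    (measurable_pi_apply i)

@[fun_prop] lemma measurable_tl (N : ℕ) : Measurable fun x => tl x N := by
  refine Finset.measurable_fun_sum _ fun i _ => ?_
  exact (measurable_of_finite fun b : Bool => if b = false then 1 else 0).comp
    (measurable_pi_apply i)

/-- The first hitting time of a countable family of events is measurable. -/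
lemma measurable_sInf_nat {α : Type*} [MeasurableSpace α] {p : ℕ → α → Prop}
    (hp : ∀ N, MeasurableSet {x | p N x}) : Measurable fun x => sInf {N | p N x} := by
  classical
  have hex : MeasurableSet {x | ∃ N, p N x} := by
    rw [Set.ofPred_exists]; exact .iUnion hp
  refine measurable_to_countable' fun k => ?_
  -- The second piece is the default `sInf ∅ = 0`: points that never hit land in the fibre over `0`.
  have : (fun x => sInf {N | p N x}) ⁻¹' {k} =
      ({x | p k x} ∩ ⋂ j < k, {x | p j x}ᶜ) ∪ {x | k = 0 ∧ ¬ ∃ N, p N x} := by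
    ext x
    simp only [Set.mem_preimage, Set.mem_singleton_iff, Set.mem_union, Set.mem_inter_iff,
      Set.mem_ofPred_eq, Set.mem_iInter, Set.mem_compl_iff]
    constructor
    · rintro rfl
      by_cases h : ∃ N, p N x
      · exact .inl ⟨Nat.sInf_mem h, fun j hj => Nat.notMem_of_lt_sInf hj⟩
      · refine .inr ⟨?_, h⟩
        rw [Nat.sInf_eq_zero]
        exact .inr (Set.eq_empty_of_forall_notMem fun N hN => h ⟨N, hN⟩)
    · rintro (⟨hk, hlt⟩ | ⟨rfl, h⟩)
      · refine le_antisymm (Nat.sInf_le hk) ?_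
        by_contra! hlt'
        exact hlt _ hlt' (Nat.sInf_mem (s := {N | p N x}) ⟨k, hk⟩)
      · rw [Nat.sInf_eq_zero]
        exact .inr (Set.eq_empty_of_forall_notMem fun N hN => h ⟨N, hN⟩)
  rw [this]
  refine ((hp k).inter (.iInter fun j => .iInter fun _ => (hp j).compl)).union ?_
  by_cases hk : k = 0
  · simp only [hk, true_and]
    exact hex.compl
  · simp [hk]

/-! ### Generating function of the sum of the two durations -/

/-- The event that `a` Heads and `b` Tails are eventually reached. -/
def IsDone (a b : ℕ) (x : ℕ → Bool) : Prop := ∃ N, a ≤ hd x N ∧ b ≤ tl x N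

/-- The number of tosses until `a` Heads or `b` Tails are reached. -/
noncomputable def orTime (a b : ℕ) (x : ℕ → Bool) : ℕ := sInf {N | a ≤ hd x N ∨ b ≤ tl x N}

/-- The number of tosses until `a` Heads and `b` Tails are reached. -/
noncomputable def andTime (a b : ℕ) (x : ℕ → Bool) : ℕ := sInf {N | a ≤ hd x N ∧ b ≤ tl x N}

open Classical in
/-- The variable `z ^ (X + Y)`, set to `0` where `Y` is infinite. -/
noncomputable def weight (z : ℂ) (a b : ℕ) (x : ℕ → Bool) : ℂ :=
  if IsDone a b x then z ^ (orTime a b x + andTime a b x) else 0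

lemma measurableSet_le_hd (a N : ℕ) : MeasurableSet {x | a ≤ hd x N} :=
  measurableSet_le measurable_const (measurable_hd N)

lemma measurableSet_le_tl (a N : ℕ) : MeasurableSet {x | a ≤ tl x N} :=
  measurableSet_le measurable_const (measurable_tl N)

lemma measurableSet_isDone (a b : ℕ) : MeasurableSet {x | IsDone a b x} := by
  simp only [IsDone, Set.ofPred_exists]
  exact .iUnion fun N => (measurableSet_le_hd a N).inter (measurableSet_le_tl b N)

lemma measurable_orTime (a b : ℕ) : Measurable (orTime a b) :=
  measurable_sInf_nat fun N => (measurableSet_le_hd a N).union (measurableSet_le_tl b N)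

lemma measurable_andTime (a b : ℕ) : Measurable (andTime a b) :=
  measurable_sInf_nat fun N => (measurableSet_le_hd a N).inter (measurableSet_le_tl b N)

lemma measurable_weight (z : ℂ) (a b : ℕ) : Measurable (weight z a b) := by
  refine Measurable.ite (measurableSet_isDone a b) ?_ measurable_const
  exact (measurable_from_top (f := fun n : ℕ => z ^ n)).comp
    ((measurable_orTime a b).add (measurable_andTime a b))

lemma norm_weight_le {z : ℂ} (hz : ‖z‖ = 1) (a b : ℕ) (x : ℕ → Bool) : ‖weight z a b x‖ ≤ 1 := by
  unfold weight
  split_ifs <;> simp [hz]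

/-- Existence of a hit is essential: with none, both infima take the default value `0` and the shift
by one fails. -/
lemma sInf_succ {p q : ℕ → Prop} (h0 : ¬ p 0) (hpq : ∀ N, p (N + 1) ↔ q N) (hq : ∃ N, q N) :
    sInf {N | p N} = sInf {N | q N} + 1 := by
  have hp : ({N | p N} : Set ℕ).Nonempty := hq.imp' (· + 1) fun N => (hpq N).2
  refine le_antisymm (Nat.sInf_le ((hpq _).2 (Nat.sInf_mem hq))) ?_
  have h := Nat.sInf_mem hp
  rcases hm : sInf {N | p N} with _ | m
  · rw [hm] at h; exact absurd h h0
  · rw [hm] at h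
    exact Nat.succ_le_succ (Nat.sInf_le ((hpq m).1 h))

lemma exists_succ_iff {p q : ℕ → Prop} (h0 : ¬ p 0) (hpq : ∀ N, p (N + 1) ↔ q N) :
    (∃ N, p N) ↔ ∃ N, q N := by
  constructor
  · rintro ⟨_ | N, h⟩
    · exact absurd h h0
    · exact ⟨N, (hpq N).1 h⟩
  · rintro ⟨N, h⟩
    exact ⟨N + 1, (hpq N).2 h⟩

lemma sInf_eq_zero_of_zero {p : ℕ → Prop} (h : p 0) : sInf {N | p N} = 0 :=
  Nat.sInf_eq_zero.2 (.inl h)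

lemma weight_zero_zero (z : ℂ) (x : ℕ → Bool) : weight z 0 0 x = 1 := by
  have h : IsDone 0 0 x := ⟨0, by simp⟩
  simp [weight, h, orTime, andTime]

/-- A toss that leaves both targets unreached takes one step of both durations. -/
lemma weight_cons_of_pos {z : ℂ} {a b a' b' : ℕ} {x y : ℕ → Bool} (ha : a ≠ 0) (hb : b ≠ 0)
    (h1 : ∀ N, a ≤ hd y (N + 1) ↔ a' ≤ hd x N) (h2 : ∀ N, b ≤ tl y (N + 1) ↔ b' ≤ tl x N) :
    weight z a b y = z ^ 2 * weight z a' b' x := by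
  have hd0 : ¬ (a ≤ hd y 0 ∧ b ≤ tl y 0) := by simp [ha]
  have hd0' : ¬ (a ≤ hd y 0 ∨ b ≤ tl y 0) := by simp [ha, hb]
  have hs : ∀ N, a ≤ hd y (N + 1) ∧ b ≤ tl y (N + 1) ↔ a' ≤ hd x N ∧ b' ≤ tl x N := by
    simp [h1, h2]
  have hs' : ∀ N, a ≤ hd y (N + 1) ∨ b ≤ tl y (N + 1) ↔ a' ≤ hd x N ∨ b' ≤ tl x N := by
    simp [h1, h2]
  have hiff : IsDone a b y ↔ IsDone a' b' x := exists_succ_iff hd0 hs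
  by_cases h : IsDone a' b' x
  · have ho : orTime a b y = orTime a' b' x + 1 :=
      sInf_succ hd0' hs' (h.imp fun N hN => .inl hN.1)
    have ht : andTime a b y = andTime a' b' x + 1 := sInf_succ hd0 hs h
    rw [weight, weight, if_pos h, if_pos (hiff.2 h), ho, ht]
    ring
  · rw [weight, weight, if_neg h, if_neg (hiff.not.2 h), mul_zero]

/-- Once one of the targets is reached, a toss takes one step of the longer duration only. -/
lemma weight_cons_of_zero {z : ℂ} {a b a' b' : ℕ} {x y : ℕ → Bool} (h0 : a = 0 ∨ b = 0)
    (h0' : a' = 0 ∨ b' = 0) (hab : ¬ (a = 0 ∧ b = 0))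
    (h1 : ∀ N, a ≤ hd y (N + 1) ↔ a' ≤ hd x N) (h2 : ∀ N, b ≤ tl y (N + 1) ↔ b' ≤ tl x N) :
    weight z a b y = z * weight z a' b' x := by
  have hd0 : ¬ (a ≤ hd y 0 ∧ b ≤ tl y 0) := by simpa using hab
  have hs : ∀ N, a ≤ hd y (N + 1) ∧ b ≤ tl y (N + 1) ↔ a' ≤ hd x N ∧ b' ≤ tl x N := by
    simp [h1, h2]
  have hiff : IsDone a b y ↔ IsDone a' b' x := exists_succ_iff hd0 hs
  have ho : orTime a b y = 0 := sInf_eq_zero_of_zero (by simpa using h0)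
  have ho' : orTime a' b' x = 0 := sInf_eq_zero_of_zero (by simpa using h0')
  by_cases h : IsDone a' b' x
  · have ht : andTime a b y = andTime a' b' x + 1 := sInf_succ hd0 hs h
    rw [weight, weight, if_pos h, if_pos (hiff.2 h), ho, ho', ht]
    ring
  · rw [weight, weight, if_neg h, if_neg (hiff.not.2 h), mul_zero]

lemma integral_weight_succ_succ {z : ℂ} (hz : ‖z‖ = 1) (a b : ℕ) :
    ∫ x, weight z (a + 1) (b + 1) x ∂coinSeq = z ^ 2 *
      ((∫ x, weight z a (b + 1) x ∂coinSeq + ∫ x, weight z (a + 1) b x ∂coinSeq) / 2) := by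
  rw [integral_coinSeq (measurable_weight _ _ _) (norm_weight_le hz _ _)]
  have h1 (x) : weight z (a + 1) (b + 1) (consSeq true x) = z ^ 2 * weight z a (b + 1) x :=
    weight_cons_of_pos (by simp) (by simp) (by simp) (by simp)
  have h2 (x) : weight z (a + 1) (b + 1) (consSeq false x) = z ^ 2 * weight z (a + 1) b x :=
    weight_cons_of_pos (by simp) (by simp) (by simp) (by simp)
  simp only [h1, h2, integral_const_mul]
  ring

lemma two_sub_ne_zero {z : ℂ} (hz : ‖z‖ = 1) : 2 - z ≠ 0 := by
  intro h
  rw [← sub_eq_zero.1 h] at hz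
  norm_num at hz

lemma integral_weight_zero_left {z : ℂ} (hz : ‖z‖ = 1) (b : ℕ) :
    ∫ x, weight z 0 b x ∂coinSeq = (z / (2 - z)) ^ b := by
  induction b with
  | zero => simp [weight_zero_zero]
  | succ b ih =>
    -- Heads no longer help, so the unknown integral `I` reappears on the right: `I = (z I + z
    -- J)/2`, with `J` the integral for target `b`. Solving for `I` requires `2 - z ≠ 0`.
    have h := integral_coinSeq (measurable_weight z 0 (b + 1)) (norm_weight_le hz _ _)
    have h1 (x) : weight z 0 (b + 1) (consSeq true x) = z * weight z 0 (b + 1) x :=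
      weight_cons_of_zero (by simp) (by simp) (by simp) (by simp) (by simp)
    have h2 (x) : weight z 0 (b + 1) (consSeq false x) = z * weight z 0 b x :=
      weight_cons_of_zero (by simp) (by simp) (by simp) (by simp) (by simp)
    simp only [h1, h2, integral_const_mul, ih] at h
    have := two_sub_ne_zero hz
    rw [pow_succ, ← sub_eq_zero, ← mul_right_inj' this, mul_zero]
    field_simp
    linear_combination (2 * h)

lemma integral_weight_zero_right {z : ℂ} (hz : ‖z‖ = 1) (a : ℕ) :
    ∫ x, weight z a 0 x ∂coinSeq = (z / (2 - z)) ^ a := by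
  induction a with
  | zero => simp [weight_zero_zero]
  | succ a ih =>
    have h := integral_coinSeq (measurable_weight z (a + 1) 0) (norm_weight_le hz _ _)
    have h1 (x) : weight z (a + 1) 0 (consSeq true x) = z * weight z a 0 x :=
      weight_cons_of_zero (by simp) (by simp) (by simp) (by simp) (by simp)
    have h2 (x) : weight z (a + 1) 0 (consSeq false x) = z * weight z (a + 1) 0 x :=
      weight_cons_of_zero (by simp) (by simp) (by simp) (by simp) (by simp)
    simp only [h1, h2, integral_const_mul, ih] at h
    have := two_sub_ne_zero hz
    rw [pow_succ, ← sub_eq_zero, ← mul_right_inj' this, mul_zero]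
    field_simp
    linear_combination (2 * h)

/-! ### Displacement at the fixed time `a + b`, and the exact identity -/

/-- The distance from the number of Heads in `a + b` tosses to `a`. -/
def excess (a b : ℕ) (x : ℕ → Bool) : ℕ := ((hd x (a + b) : ℤ) - a).natAbs

@[fun_prop] lemma measurable_excess (a b : ℕ) : Measurable (excess a b) :=
  (measurable_from_top (f := fun n : ℕ => ((n : ℤ) - a).natAbs)).comp (measurable_hd (a + b))

lemma excess_le (a b : ℕ) (x : ℕ → Bool) : excess a b x ≤ a + b := by
  have := hd_le x (a + b)
  unfold excess
  omega

lemma measurable_pow_excess (q : ℂ) (a b : ℕ) : Measurable fun x => q ^ excess a b x :=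
  (measurable_from_top (f := fun n : ℕ => q ^ n)).comp (measurable_excess a b)

/-- A crude bound serving only integrability; the base `1 + ‖q‖` covers `‖q‖ > 1`. -/
lemma norm_pow_excess_le (q : ℂ) (a b : ℕ) (x : ℕ → Bool) :
    ‖q ^ excess a b x‖ ≤ (1 + ‖q‖) ^ (a + b) := by
  rw [norm_pow]
  calc ‖q‖ ^ excess a b x ≤ (1 + ‖q‖) ^ excess a b x := by gcongr; linarith
    _ ≤ (1 + ‖q‖) ^ (a + b) := by
      gcongr
      · linarith [norm_nonneg q]
      · exact excess_le a b x

lemma integral_pow_excess_succ_succ (q : ℂ) (a b : ℕ) :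
    ∫ x, q ^ excess (a + 1) (b + 1) x ∂coinSeq =
      (∫ x, q ^ excess a (b + 1) x ∂coinSeq + ∫ x, q ^ excess (a + 1) b x ∂coinSeq) / 2 := by
  rw [integral_coinSeq (measurable_pow_excess _ _ _) (norm_pow_excess_le q _ _)]
  have h1 (x) : excess (a + 1) (b + 1) (consSeq true x) = excess a (b + 1) x := by
    simp only [excess]
    rw [show a + 1 + (b + 1) = a + (b + 1) + 1 by ring, hd_cons_true]
    congr 1
    push_cast
    ring
  have h2 (x) : excess (a + 1) (b + 1) (consSeq false x) = excess (a + 1) b x := by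
    simp only [excess]
    rw [← add_assoc, hd_cons_false]
  simp only [h1, h2]

/-- With `a = 0` the displacement is the number of Heads in `b` tosses, so this is the binomial
generating function. With `b = 0` it is the number of Tails. -/
lemma integral_pow_excess_zero_left (q : ℂ) (b : ℕ) :
    ∫ x, q ^ excess 0 b x ∂coinSeq = ((1 + q) / 2) ^ b := by
  induction b with
  | zero => simp [excess]
  | succ b ih =>
    rw [integral_coinSeq (measurable_pow_excess _ _ _) (norm_pow_excess_le q _ _)]
    have h1 (x) : q ^ excess 0 (b + 1) (consSeq true x) = q * q ^ excess 0 b x := by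
      rw [← pow_succ']
      congr 1
      simp only [excess, ← add_assoc, hd_cons_true]
      omega
    have h2 (x) : excess 0 (b + 1) (consSeq false x) = excess 0 b x := by
      simp only [excess, ← add_assoc, hd_cons_false]
    simp only [h1, h2, integral_const_mul, ih]
    ring

lemma integral_pow_excess_zero_right (q : ℂ) (a : ℕ) :
    ∫ x, q ^ excess a 0 x ∂coinSeq = ((1 + q) / 2) ^ a := by
  induction a with
  | zero => simp [excess]
  | succ a ih =>
    rw [integral_coinSeq (measurable_pow_excess _ _ _) (norm_pow_excess_le q _ _)]
    have h1 (x) : excess (a + 1) 0 (consSeq true x) = excess a 0 x := by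
      simp only [excess, add_zero, hd_cons_true]
      omega
    have h2 (x) : q ^ excess (a + 1) 0 (consSeq false x) = q * q ^ excess a 0 x := by
      rw [← pow_succ']
      congr 1
      have := hd_le x a
      simp only [excess, add_zero, hd_cons_false]
      omega
    simp only [h1, h2, integral_const_mul, ih]
    ring

/-- The generating function of `X + Y` in terms of the position of the walk at time `a + b`. -/
theorem integral_weight {z : ℂ} (hz : ‖z‖ = 1) (a b : ℕ) :
    ∫ x, weight z a b x ∂coinSeq =
      z ^ (2 * (a + b)) * ∫ x, (2 / (z * (2 - z)) - 1) ^ excess a b x ∂coinSeq := by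
  have hz0 : z ≠ 0 := by rintro rfl; simp at hz
  have hz2 := two_sub_ne_zero hz
  -- This equation dictates `q`: it matches the boundary values `(z/(2-z))^b` and `z^(2b)
  -- ((1+q)/2)^b`.
  have hu : z / (2 - z) = z ^ 2 * ((1 + (2 / (z * (2 - z)) - 1)) / 2) := by
    field_simp
    ring
  set q := 2 / (z * (2 - z)) - 1
  induction a generalizing b with
  | zero => rw [integral_weight_zero_left hz, integral_pow_excess_zero_left, hu]; ring
  | succ a iha =>
    induction b with
    | zero => rw [integral_weight_zero_right hz, integral_pow_excess_zero_right, hu]; ring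
    | succ b ihb =>
      rw [integral_weight_succ_succ hz, integral_pow_excess_succ_succ, iha, ihb]
      ring

/-- At `z = 1` the multiplier is `1`, and `weight` is the indicator of termination because it
vanishes elsewhere. The identity then says that this event has probability one. -/
lemma ae_isDone (a b : ℕ) : ∀ᵐ x ∂coinSeq, IsDone a b x := by
  have h := integral_weight (z := 1) (by simp) a b
  have h1 : weight 1 a b = {x | IsDone a b x}.indicator fun _ => 1 := by
    ext x
    simp only [weight, one_pow]
    rfl
  rw [h1, integral_indicator_const _ (measurableSet_isDone a b)] at h
  norm_num at h
  exact (mem_ae_iff_prob_eq_one (measurableSet_isDone a b)).2 (by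
    simpa [Measure.real, ENNReal.toReal_eq_one_iff] using h)

/-! ### Moments of the displacement and the cost of changing the base `q` -/

lemma integral_sq_two_mul_hd_sub (N : ℕ) :
    ∫ x, (2 * (hd x N : ℝ) - N) ^ 2 ∂coinSeq = (N : ℝ) := by
  have hm (N : ℕ) : Measurable fun x => (2 * (hd x N : ℝ) - N) ^ 2 := by
    have : Measurable fun x => (hd x N : ℝ) := measurable_from_top.comp (measurable_hd N)
    fun_prop
  have hb (N : ℕ) (x) : |2 * (hd x N : ℝ) - N| ≤ N := by
    have h : (hd x N : ℝ) ≤ N := mod_cast hd_le x N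
    rw [abs_le]
    constructor <;> linarith [Nat.cast_nonneg (α := ℝ) (hd x N)]
  have hb2 (N : ℕ) (x) : ‖(2 * (hd x N : ℝ) - N) ^ 2‖ ≤ (N : ℝ) ^ 2 := by
    rw [norm_pow]
    exact pow_le_pow_left₀ (norm_nonneg _) (hb N x) 2
  induction N with
  | zero => simp
  | succ N ih =>
    have hi (c : ℝ) : Integrable (fun x => (2 * (hd x N : ℝ) - N + c) ^ 2) coinSeq := by
      have : Measurable fun x => (hd x N : ℝ) := measurable_from_top.comp (measurable_hd N)
      refine .of_bound (C := ((N : ℝ) + |c|) ^ 2) (by fun_prop) (.of_forall fun x => ?_)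
      rw [norm_pow]
      exact pow_le_pow_left₀ (norm_nonneg _) ((abs_add_le _ _).trans (by gcongr; exact hb N x)) 2
    rw [integral_coinSeq (hm _) (hb2 _)]
    simp only [hd_cons_true, hd_cons_false]
    have e1 (x) : (2 * ((hd x N + 1 : ℕ) : ℝ) - (N + 1 : ℕ)) ^ 2 = (2 * (hd x N : ℝ) - N + 1) ^ 2 := by
      push_cast; ring
    have e2 (x) : (2 * (hd x N : ℝ) - (N + 1 : ℕ)) ^ 2 = (2 * (hd x N : ℝ) - N + (-1)) ^ 2 := by
      push_cast; ring
    simp only [e1, e2]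
    rw [← integral_add (hi _) (hi _)]
    have e3 (x) : (2 * (hd x N : ℝ) - N + 1) ^ 2 + (2 * (hd x N : ℝ) - N + (-1)) ^ 2 =
        2 * (2 * (hd x N : ℝ) - N) ^ 2 + 2 := by ring
    have h0 : Integrable (fun x => (2 * (hd x N : ℝ) - N) ^ 2) coinSeq := by simpa using hi 0
    simp only [e3]
    rw [integral_add (h0.const_mul 2) (integrable_const _), integral_const_mul, ih]
    simp
    ring

lemma two_mul_excess (n : ℕ) (x : ℕ → Bool) :
    2 * (excess n n x : ℝ) = |2 * (hd x (2 * n) : ℝ) - (2 * n : ℕ)| := by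
  rw [excess, Nat.cast_natAbs, ← two_mul]
  push_cast
  rw [← mul_sub, abs_mul, abs_two]

lemma integrable_excess (n : ℕ) : Integrable (fun x => (excess n n x : ℝ)) coinSeq := by
  refine .of_bound (C := n + n)
    (measurable_from_top.comp (measurable_excess n n)).aestronglyMeasurable
    (.of_forall fun x => ?_)
  simpa using (show (excess n n x : ℝ) ≤ ((n + n : ℕ) : ℝ) from mod_cast excess_le n n x)

/-- The second moment is `n / 2`, and nonnegativity of the variance bounds the squared mean by it.
-/
lemma integral_excess_le (n : ℕ) : ∫ x, (excess n n x : ℝ) ∂coinSeq ≤ √n := by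
  have h2 : ∫ x, (excess n n x : ℝ) ^ 2 ∂coinSeq = n / 2 := by
    have h := integral_sq_two_mul_hd_sub (2 * n)
    simp_rw [← sq_abs (2 * (hd _ (2 * n) : ℝ) - (2 * n : ℕ)), ← two_mul_excess, mul_pow] at h
    rw [integral_const_mul] at h
    push_cast at h
    linarith
  have hv := variance_nonneg (fun x => (excess n n x : ℝ)) coinSeq
  rw [variance_eq_sub] at hv
  · simp only [Pi.pow_apply] at hv
    rw [h2] at hv
    refine Real.le_sqrt_of_sq_le ?_
    have : (0 : ℝ) ≤ n := n.cast_nonneg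
    linarith
  · refine MemLp.of_bound (integrable_excess n).aestronglyMeasurable (n + n)
      (.of_forall fun x => ?_)
    simpa using (show (excess n n x : ℝ) ≤ ((n + n : ℕ) : ℝ) from mod_cast excess_le n n x)

/-- The bound is linear in `k`, so after integration only the mean displacement enters. -/
lemma norm_pow_sub_pow_le {q r : ℂ} (hq : ‖q‖ ≤ 1) (hr : ‖r‖ ≤ 1) (k : ℕ) :
    ‖q ^ k - r ^ k‖ ≤ k * ‖q - r‖ := by
  induction k with
  | zero => simp
  | succ k ih =>
    have h : q ^ (k + 1) - r ^ (k + 1) = q * (q ^ k - r ^ k) + (q - r) * r ^ k := by ring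
    calc ‖q ^ (k + 1) - r ^ (k + 1)‖ ≤ ‖q‖ * ‖q ^ k - r ^ k‖ + ‖q - r‖ * ‖r‖ ^ k := by
          rw [h, ← norm_mul, ← norm_pow, ← norm_mul]
          exact norm_add_le _ _
      _ ≤ 1 * (k * ‖q - r‖) + ‖q - r‖ * 1 := by
          gcongr
          exact pow_le_one₀ (norm_nonneg _) hr
      _ = (k + 1 : ℕ) * ‖q - r‖ := by push_cast; ring

lemma norm_integral_pow_sub_le {q r : ℂ} (hq : ‖q‖ ≤ 1) (hr : ‖r‖ ≤ 1) (n : ℕ) :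
    ‖∫ x, q ^ excess n n x ∂coinSeq - ∫ x, r ^ excess n n x ∂coinSeq‖ ≤ √n * ‖q - r‖ := by
  have hi (p : ℂ) : Integrable (fun x => p ^ excess n n x) coinSeq :=
    .of_bound (measurable_pow_excess p n n).aestronglyMeasurable _
      (.of_forall (norm_pow_excess_le p n n))
  rw [← integral_sub (hi q) (hi r)]
  calc _ ≤ ∫ x, (excess n n x : ℝ) * ‖q - r‖ ∂coinSeq :=
        norm_integral_le_of_norm_le ((integrable_excess n).mul_const _)
          (.of_forall fun x => norm_pow_sub_pow_le hq hr _)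
    _ ≤ √n * ‖q - r‖ := by
        rw [integral_mul_const]
        gcongr
        exact integral_excess_le n

/-! ### The multiplier near frequency zero -/

/-- The multiplier `q` attached to the frequency `s`. -/
noncomputable def multiplier (s : ℝ) : ℂ :=
  2 / (Complex.exp (s * Complex.I) * (2 - Complex.exp (s * Complex.I))) - 1

/-- Using `1/z = conj z`, the multiplier is `(2 conj z - 2 + z)/(2 - z)`. The squared norm of the
denominator exceeds that of the numerator by `8 cos s (1 - cos s)`. -/
lemma norm_multiplier_le {s : ℝ} (hs : 0 ≤ Real.cos s) : ‖multiplier s‖ ≤ 1 := by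
  have hz : ‖Complex.exp (s * Complex.I)‖ = 1 := Complex.norm_exp_ofReal_mul_I s
  have h2 := two_sub_ne_zero hz
  have he := Complex.exp_ne_zero (s * Complex.I)
  have h : multiplier s = (2 * (starRingEnd ℂ (Complex.exp (s * Complex.I))) - 2 +
      Complex.exp (s * Complex.I)) / (2 - Complex.exp (s * Complex.I)) := by
    have hc : Complex.exp (s * Complex.I) * starRingEnd ℂ (Complex.exp (s * Complex.I)) = 1 := by
      rw [Complex.mul_conj, Complex.normSq_eq_norm_sq, hz]; simp
    rw [multiplier]
    field_simp
    linear_combination (-2) * hc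
  rw [h, norm_div, div_le_one (norm_pos_iff.2 h2),
    ← sq_le_sq₀ (norm_nonneg _) (norm_nonneg _), ← Complex.normSq_eq_norm_sq,
    ← Complex.normSq_eq_norm_sq, Complex.normSq_apply, Complex.normSq_apply]
  simp only [Complex.add_re, Complex.sub_re, Complex.mul_re, Complex.conj_re,
    Complex.exp_ofReal_mul_I_re, Complex.add_im, Complex.sub_im, Complex.mul_im, Complex.conj_im,
    Complex.exp_ofReal_mul_I_im, Complex.re_ofNat, Complex.im_ofNat]
  nlinarith [Real.sin_sq_add_cos_sq s, Real.cos_le_one s,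
    mul_nonneg hs (sub_nonneg.2 (Real.cos_le_one s))]

/-- The second-order expansion of the multiplier at frequency zero. -/
lemma tendsto_multiplier :
    Tendsto (fun s : ℝ => (multiplier s - Complex.exp (-2 * (s : ℂ) ^ 2)) / (s : ℂ) ^ 2)
      (𝓝[≠] 0) (𝓝 0) := by
  have hd1 : HasDerivAt (fun s : ℝ => Complex.exp (s * Complex.I)) Complex.I 0 := by
    have h := ((Complex.ofRealCLM.hasDerivAt (x := (0 : ℝ))).mul_const Complex.I).cexp
    simpa using h
  have h1 : Tendsto (fun s : ℝ => (Complex.exp (s * Complex.I) - 1) / s) (𝓝[≠] 0)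
      (𝓝 Complex.I) := by
    refine (hasDerivAt_iff_tendsto_slope.1 hd1).congr fun s => ?_
    simp [slope_def_module, div_eq_inv_mul]
  have hz : Tendsto (fun s : ℝ => Complex.exp (s * Complex.I)) (𝓝[≠] 0) (𝓝 1) := by
    have := hd1.continuousAt.tendsto
    simp only [Complex.ofReal_zero, zero_mul, Complex.exp_zero] at this
    exact this.mono_left nhdsWithin_le_nhds
  have hd2 : HasDerivAt (fun v : ℝ => Complex.exp (-2 * v)) (-2) 0 := by
    have h := ((Complex.ofRealCLM.hasDerivAt (x := (0 : ℝ))).const_mul (-2)).cexp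
    simpa using h
  have h2 : Tendsto (fun v : ℝ => (Complex.exp (-2 * v) - 1) / v) (𝓝[≠] 0) (𝓝 (-2)) := by
    refine (hasDerivAt_iff_tendsto_slope.1 hd2).congr fun s => ?_
    simp [slope_def_module, div_eq_inv_mul]
  have hsq : Tendsto (fun s : ℝ => s ^ 2) (𝓝[≠] 0) (𝓝[≠] 0) := by
    refine tendsto_nhdsWithin_iff.2 ⟨?_, ?_⟩
    · have : Tendsto (fun s : ℝ => s ^ 2) (𝓝 0) (𝓝 (0 ^ 2)) := (continuous_pow 2).tendsto 0
      simpa using this.mono_left nhdsWithin_le_nhds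
    · filter_upwards [self_mem_nhdsWithin] with s hs
      exact pow_ne_zero 2 hs
  have h3 := h2.comp hsq
  -- Since `q - 1 = 2(z-1)²/(z(2-z))`, this function is `(q - 1)/s²`, so a first derivative of `z`
  -- suffices. Its limit `-2` cancels that of `(e^(-2s²) - 1)/s²`.
  have h4 : Tendsto (fun s : ℝ => 2 * ((Complex.exp (s * Complex.I) - 1) / s) ^ 2 /
      (Complex.exp (s * Complex.I) * (2 - Complex.exp (s * Complex.I)))) (𝓝[≠] 0)
      (𝓝 (2 * Complex.I ^ 2 / (1 * (2 - 1)))) :=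
    ((h1.pow 2).const_mul 2).div (hz.mul (hz.const_sub 2)) (by norm_num)
  have h5 := h4.sub h3
  norm_num at h5
  refine h5.congr' ?_
  filter_upwards [self_mem_nhdsWithin] with s hs
  have hs' : (s : ℂ) ≠ 0 := by simpa using hs
  have hz2 := two_sub_ne_zero (Complex.norm_exp_ofReal_mul_I s)
  have he := Complex.exp_ne_zero (s * Complex.I)
  simp only [multiplier]
  field_simp
  ring

lemma sq_rpow_quarter (n : ℕ) : ((n : ℝ) ^ (1 / 4 : ℝ)) ^ 2 = √n := by
  rw [← Real.rpow_natCast, ← Real.rpow_mul n.cast_nonneg, Real.sqrt_eq_rpow]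
  norm_num

lemma tendsto_div_rpow_quarter (t : ℝ) :
    Tendsto (fun n : ℕ => t / (n : ℝ) ^ (1 / 4 : ℝ)) atTop (𝓝 0) :=
  ((tendsto_rpow_atTop (by norm_num)).comp tendsto_natCast_atTop_atTop).const_div_atTop t

lemma tendsto_integral_pow_multiplier_sub (t : ℝ) :
    Tendsto (fun n : ℕ =>
      ∫ x, multiplier (t / (n : ℝ) ^ (1 / 4 : ℝ)) ^ excess n n x ∂coinSeq -
      ∫ x, Complex.exp (-2 * ((t / (n : ℝ) ^ (1 / 4 : ℝ) : ℝ) : ℂ) ^ 2) ^ excess n n x ∂coinSeq)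
      atTop (𝓝 0) := by
  -- At `t = 0` both bases equal `1`; otherwise the frequency is eventually nonzero, as the
  -- punctured limit requires.
  rcases eq_or_ne t 0 with rfl | ht
  · norm_num [multiplier]
  have hs := tendsto_div_rpow_quarter t
  have hs' : Tendsto (fun n : ℕ => t / (n : ℝ) ^ (1 / 4 : ℝ)) atTop (𝓝[≠] 0) := by
    refine tendsto_nhdsWithin_iff.2 ⟨hs, ?_⟩
    filter_upwards [eventually_gt_atTop 0] with n hn
    have : (0 : ℝ) < n := mod_cast hn
    exact div_ne_zero ht (by positivity)
  have hcos : ∀ᶠ n : ℕ in atTop, 0 ≤ Real.cos (t / (n : ℝ) ^ (1 / 4 : ℝ)) := by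
    have : Tendsto (fun n : ℕ => Real.cos (t / (n : ℝ) ^ (1 / 4 : ℝ))) atTop (𝓝 1) := by
      have h := (Real.continuous_cos.tendsto 0).comp hs
      rwa [Real.cos_zero] at h
    exact (this.eventually (lt_mem_nhds zero_lt_one)).mono fun n => le_of_lt
  have hlim := ((tendsto_multiplier.comp hs').norm).const_mul (t ^ 2)
  rw [norm_zero, mul_zero] at hlim
  refine squeeze_zero_norm' ?_ hlim
  filter_upwards [hcos, eventually_gt_atTop 0] with n hn hn0
  have hn1 : (0 : ℝ) < n := mod_cast hn0
  refine (norm_integral_pow_sub_le (norm_multiplier_le hn) ?_ n).trans_eq ?_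
  · rw [← Complex.ofReal_pow, Complex.norm_exp]
    refine Real.exp_le_one_iff.2 ?_
    simp only [Complex.mul_re, Complex.neg_re, Complex.re_ofNat, Complex.ofReal_re,
      Complex.ofReal_im, mul_zero, sub_zero]
    nlinarith [sq_nonneg (t / (n : ℝ) ^ (1 / 4 : ℝ))]
  -- Here `√n · s² = t²`, which is where the exponent `1/4` is used.
  · simp only [Function.comp, norm_div, norm_pow, Complex.norm_real, Real.norm_eq_abs, sq_abs,
      div_pow, sq_rpow_quarter]
    have : √(n : ℝ) ≠ 0 := by positivity
    field_simp

/-! ### Central limit theorem for the displacement -/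

/-- The value of a toss: `1` for Heads and `-1` for Tails. -/
def sgn (b : Bool) : ℝ := if b = true then 1 else -1

@[fun_prop] lemma measurable_sgn : Measurable sgn := measurable_of_finite _

lemma sum_sgn (x : ℕ → Bool) (N : ℕ) :
    ∑ k ∈ Finset.range N, sgn (x k) = 2 * (hd x N : ℝ) - N := by
  induction N with
  | zero => simp
  | succ N ih =>
    rw [Finset.sum_range_succ, ih]
    simp only [hd, Finset.sum_range_succ]
    cases x N <;> simp [sgn] <;> ring

lemma identDistrib_eval (i : ℕ) :
    IdentDistrib (fun x : ℕ → Bool => sgn (x i)) (fun x => sgn (x 0)) coinSeq coinSeq := by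
  have h : IdentDistrib (fun x : ℕ → Bool => x i) (fun x => x 0) coinSeq coinSeq :=
    ⟨(measurable_pi_apply i).aemeasurable, (measurable_pi_apply 0).aemeasurable, by
      rw [coinSeq, Measure.infinitePi_map_eval (fun _ => coin) i,
        Measure.infinitePi_map_eval (fun _ => coin) 0]⟩
  exact h.comp measurable_sgn

lemma integral_comp_eval (f : Bool → ℝ) :
    ∫ x, f (x 0) ∂coinSeq = (f true + f false) / 2 := by
  have hf : Measurable f := measurable_of_finite f
  rw [integral_coinSeq (f := fun x : ℕ → Bool => f (x 0)) (by fun_prop)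
    (C := max ‖f true‖ ‖f false‖) fun x => by cases x 0 <;> simp]
  simp

theorem tendstoInDistribution_walk {Ω' : Type*} [MeasurableSpace Ω'] {P' : Measure Ω'}
    [IsProbabilityMeasure P'] {Z : Ω' → ℝ} (hZ : HasLaw Z (gaussianReal 0 1) P') :
    TendstoInDistribution (fun (n : ℕ) (x : ℕ → Bool) =>
      (√n)⁻¹ * ∑ k ∈ Finset.range n, sgn (x k)) atTop Z (fun _ => coinSeq) P' := by
  refine tendstoInDistribution_inv_sqrt_mul_sum (X := fun k (x : ℕ → Bool) => sgn (x k)) hZ ?_ ?_ ?_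
    identDistrib_eval
  · rw [integral_comp_eval sgn]; simp [sgn]
  · have := integral_comp_eval fun b => sgn b ^ 2
    simp only [Pi.pow_apply]
    rw [this]; simp [sgn]
  · exact iIndepFun_infinitePi (X := fun _ => sgn) fun _ => measurable_sgn

lemma tendsto_integral_exp_abs_walk {Ω' : Type*} [MeasurableSpace Ω'] {P' : Measure Ω'}
    [IsProbabilityMeasure P'] {Z : Ω' → ℝ} (hZ : HasLaw Z (gaussianReal 0 1) P') {c : ℝ}
    (hc : 0 ≤ c) :
    Tendsto (fun n : ℕ => ∫ x : ℕ → Bool,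
      Real.exp (-c * |(√n)⁻¹ * ∑ k ∈ Finset.range n, sgn (x k)|) ∂coinSeq) atTop
      (𝓝 (∫ ω, Real.exp (-c * |Z ω|) ∂P')) := by
  have h := tendstoInDistribution_walk hZ
  let f : BoundedContinuousFunction ℝ ℝ := .ofNormedAddCommGroup
    (fun v => Real.exp (-c * |v|)) (by fun_prop) 1 fun v => by
      rw [Real.norm_eq_abs, Real.abs_exp]
      exact Real.exp_le_one_iff.2 (by nlinarith [abs_nonneg v])
  have h1 := ProbabilityMeasure.tendsto_iff_forall_integral_tendsto.1 h.tendsto f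
  simp only [ProbabilityMeasure.coe_mk] at h1
  rw [integral_map h.aemeasurable_limit f.continuous.aestronglyMeasurable] at h1
  refine h1.congr fun n => ?_
  rw [integral_map (h.forall_aemeasurable n) f.continuous.aestronglyMeasurable]
  rfl

lemma tendsto_integral_exp_pow_excess {Ω' : Type*} [MeasurableSpace Ω'] {P' : Measure Ω'}
    [IsProbabilityMeasure P'] {Z : Ω' → ℝ} (hZ : HasLaw Z (gaussianReal 0 1) P') (t : ℝ) :
    Tendsto (fun n : ℕ => ∫ x,
      Complex.exp (-2 * ((t / (n : ℝ) ^ (1 / 4 : ℝ) : ℝ) : ℂ) ^ 2) ^ excess n n x ∂coinSeq)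
      atTop (𝓝 ((∫ ω, Real.exp (-(√2 * t ^ 2) * |Z ω|) ∂P' : ℝ) : ℂ)) := by
  -- The walk is taken at time `2n`, where `|S| = 2D`. The constant comes from `2s²D = (t²/√n)|S| =
  -- √2 t² · |S|/√(2n)`.
  have h := ((tendsto_integral_exp_abs_walk hZ (c := √2 * t ^ 2) (by positivity)).comp
    (tendsto_id.const_mul_atTop' (zero_lt_two' ℕ))).ofReal
  refine h.congr' ?_
  filter_upwards [eventually_gt_atTop 0] with n hn
  have hn1 : (0 : ℝ) < n := mod_cast hn
  have h2 : √(n : ℝ) ≠ 0 := by positivity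
  simp only [Function.comp, id]
  rw [← integral_complex_ofReal]
  refine integral_congr_ae (.of_forall fun x => ?_)
  simp only
  rw [sum_sgn, abs_mul, ← two_mul_excess, ← Complex.exp_nat_mul]
  rw [show (excess n n x : ℂ) * (-2 * ((t / (n : ℝ) ^ (1 / 4 : ℝ) : ℝ) : ℂ) ^ 2) =
    ((excess n n x * (-2 * (t / (n : ℝ) ^ (1 / 4 : ℝ)) ^ 2) : ℝ) : ℂ) by push_cast; ring,
    ← Complex.ofReal_exp]
  congr 2
  rw [div_pow, sq_rpow_quarter, abs_of_nonneg (by positivity)]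
  push_cast
  rw [Real.sqrt_mul zero_le_two]
  field_simp

/-! ### The mixed Gaussian limit -/

/-- The characteristic function of the limit law. -/
lemma charFun_limit {Ω' : Type*} [MeasurableSpace Ω'] {P' : Measure Ω'}
    [IsProbabilityMeasure P'] {Z W : Ω' → ℝ} (hZ : AEMeasurable Z P')
    (hW : HasLaw W (gaussianReal 0 1) P') (hZW : IndepFun Z W P') (t : ℝ) :
    charFun (P'.map fun ω => (2 : ℝ) ^ (3 / 4 : ℝ) * |Z ω| ^ (1 / 2 : ℝ) * W ω) t =
      ((∫ ω, Real.exp (-(√2 * t ^ 2) * |Z ω|) ∂P' : ℝ) : ℂ) := by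
  have hWm := hW.aemeasurable
  -- With `Z` frozen at `z` the law is normal with variance `2√2 |z|`, and half of this times `t²`
  -- is `√2 t² |z|`.
  have hG : ∀ z : ℝ, ∫ w, Complex.exp (t * ((2 : ℝ) ^ (3 / 4 : ℝ) * |z| ^ (1 / 2 : ℝ) * w : ℝ) *
      Complex.I) ∂(gaussianReal 0 1) = (Real.exp (-(√2 * t ^ 2) * |z|) : ℂ) := by
    intro z
    have h := charFun_gaussianReal (μ := 0) (v := 1) (t * ((2 : ℝ) ^ (3 / 4 : ℝ) * |z| ^ (1 / 2 : ℝ)))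
    rw [charFun_apply_real] at h
    have h2 : ((2 : ℝ) ^ (3 / 4 : ℝ)) ^ 2 = 2 * √2 := by
      rw [← Real.rpow_natCast, ← Real.rpow_mul zero_le_two, Real.sqrt_eq_rpow]
      rw [show (3 / 4 : ℝ) * (2 : ℕ) = 1 + 1 / 2 by norm_num, Real.rpow_add zero_lt_two,
        Real.rpow_one]
    have h3 : (|z| ^ (1 / 2 : ℝ)) ^ 2 = |z| := by
      rw [← Real.sqrt_eq_rpow, Real.sq_sqrt (abs_nonneg z)]
    calc _ = _ := by
          refine integral_congr_ae (.of_forall fun w => ?_)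
          simp only
          congr 2
          push_cast
          ring
      _ = _ := h
      _ = _ := by
          rw [Complex.ofReal_exp]
          congr 1
          simp only [Complex.ofReal_zero, mul_zero, zero_mul, zero_sub, NNReal.coe_one,
            Complex.ofReal_one, one_mul]
          rw [← Complex.ofReal_pow, mul_pow, mul_pow, h2, h3]
          push_cast
          ring
  have hmap : P'.map (fun ω => (Z ω, W ω)) = (P'.map Z).prod (gaussianReal 0 1) := by
    rw [(indepFun_iff_map_prod_eq_prod_map_map hZ hWm).1 hZW, hW.map_eq]
  have hprob : IsProbabilityMeasure (P'.map Z) := Measure.isProbabilityMeasure_map hZ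
  have hm : Measurable fun p : ℝ × ℝ => Complex.exp (t *
      ((2 : ℝ) ^ (3 / 4 : ℝ) * |p.1| ^ (1 / 2 : ℝ) * p.2 : ℝ) * Complex.I) := by fun_prop
  rw [charFun_apply_real, integral_map (by fun_prop) (by fun_prop)]
  calc _ = ∫ p : ℝ × ℝ, Complex.exp (t *
      ((2 : ℝ) ^ (3 / 4 : ℝ) * |p.1| ^ (1 / 2 : ℝ) * p.2 : ℝ) * Complex.I)
        ∂(P'.map fun ω => (Z ω, W ω)) := by
        rw [integral_map (by fun_prop) hm.aestronglyMeasurable]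
    _ = _ := by
        rw [hmap, integral_prod]
        · simp only [hG]
          rw [integral_map hZ (by fun_prop), integral_complex_ofReal]
        · refine .of_bound hm.aestronglyMeasurable 1 (.of_forall fun p => ?_)
          rw [← Complex.ofReal_mul, Complex.norm_exp_ofReal_mul_I]

/-! ### Transfer to arbitrary fair tosses -/

section Tosses

variable {Ω : Type*}

/-- The sequence of tosses, with `true` for Heads. -/
def toBool (ξ : ℕ → Ω → ℤ) (ω : Ω) (i : ℕ) : Bool := decide (ξ (i + 1) ω = 1)

lemma heads_eq (ξ : ℕ → Ω → ℤ) (N : ℕ) (ω : Ω) : heads ξ N ω = hd (toBool ξ ω) N := by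
  rw [heads, hd, Finset.card_filter]
  induction N with
  | zero => simp
  | succ N ih =>
    rw [Finset.sum_Icc_succ_top (by omega), ih, Finset.sum_range_succ]
    simp only [toBool, decide_eq_true_eq]

lemma tails_eq {ξ : ℕ → Ω → ℤ} {ω : Ω} (h : ∀ i, ξ i ω = 1 ∨ ξ i ω = -1) (N : ℕ) :
    tails ξ N ω = tl (toBool ξ ω) N := by
  rw [tails, tl, Finset.card_filter]
  induction N with
  | zero => simp
  | succ N ih =>
    rw [Finset.sum_Icc_succ_top (by omega), ih, Finset.sum_range_succ]
    congr 1
    rcases h (N + 1) with h | h <;> simp [toBool, h]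

lemma hd_succ_le (x : ℕ → Bool) (N : ℕ) : hd x (N + 1) ≤ hd x N + 1 := by
  simp only [hd, Finset.sum_range_succ]
  split_ifs <;> omega

lemma tl_succ_le (x : ℕ → Bool) (N : ℕ) : tl x (N + 1) ≤ tl x N + 1 := by
  simp only [tl, Finset.sum_range_succ]
  split_ifs <;> omega

/-- Counts grow by at most one per toss, so a level is first passed by equality. The form with `≤`
is the one suited to the recursion, as a target once met stays met. -/
lemma sInf_hd_eq_or_tl_eq {n : ℕ} {x : ℕ → Bool} (h : IsDone n n x) :
    sInf {N | hd x N = n ∨ tl x N = n} = orTime n n x := by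
  have hne : {N | n ≤ hd x N ∨ n ≤ tl x N}.Nonempty := h.imp fun N hN => .inl hN.1
  have hmem : orTime n n x ∈ {N | hd x N = n ∨ tl x N = n} := by
    have hle := Nat.sInf_mem hne
    have hlt : ∀ m < orTime n n x, ¬ (n ≤ hd x m ∨ n ≤ tl x m) :=
      fun m hm => Nat.notMem_of_lt_sInf hm
    change n ≤ hd x (orTime n n x) ∨ n ≤ tl x (orTime n n x) at hle
    change hd x (orTime n n x) = n ∨ tl x (orTime n n x) = n
    generalize orTime n n x = T at hle hlt ⊢
    rcases T with _ | m
    · simp only [hd_zero, tl_zero] at hle ⊢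
      omega
    · have := hlt m (Nat.lt_succ_self m)
      have := hd_succ_le x m
      have := tl_succ_le x m
      omega
  refine le_antisymm (Nat.sInf_le hmem) (Nat.sInf_le ?_)
  exact (Nat.sInf_mem ⟨_, hmem⟩).imp (fun h => h.ge) fun h => h.ge

lemma orDuration_eq {ξ : ℕ → Ω → ℤ} {ω : Ω} (h : ∀ i, ξ i ω = 1 ∨ ξ i ω = -1) {n : ℕ}
    (hd : IsDone n n (toBool ξ ω)) : orDuration ξ n ω = orTime n n (toBool ξ ω) := by
  simp only [orDuration, heads_eq, tails_eq h, sInf_hd_eq_or_tl_eq hd]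

lemma andDuration_eq {ξ : ℕ → Ω → ℤ} {ω : Ω} (h : ∀ i, ξ i ω = 1 ∨ ξ i ω = -1) (n : ℕ) :
    andDuration ξ n ω = andTime n n (toBool ξ ω) := by
  simp only [andDuration, heads_eq, tails_eq h, andTime]

variable [MeasurableSpace Ω]

lemma measurable_heads {ξ : ℕ → Ω → ℤ} (hξ : ∀ i, Measurable (ξ i)) (N : ℕ) :
    Measurable (heads ξ N) := by
  have : heads ξ N = fun ω => ∑ i ∈ Finset.Icc 1 N, if ξ i ω = 1 then 1 else 0 := by
    ext ω; rw [heads, Finset.card_filter]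
  rw [this]
  refine Finset.measurable_fun_sum _ fun i _ => ?_
  exact .ite (hξ i (measurableSet_singleton 1)) measurable_const measurable_const

lemma measurable_tails {ξ : ℕ → Ω → ℤ} (hξ : ∀ i, Measurable (ξ i)) (N : ℕ) :
    Measurable (tails ξ N) := by
  have : tails ξ N = fun ω => ∑ i ∈ Finset.Icc 1 N, if ξ i ω = -1 then 1 else 0 := by
    ext ω; rw [tails, Finset.card_filter]
  rw [this]
  refine Finset.measurable_fun_sum _ fun i _ => ?_
  exact .ite (hξ i (measurableSet_singleton (-1))) measurable_const measurable_const

lemma measurable_orDuration {ξ : ℕ → Ω → ℤ} (hξ : ∀ i, Measurable (ξ i)) (n : ℕ) :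
    Measurable (orDuration ξ n) :=
  measurable_sInf_nat fun N => (measurable_heads hξ N (measurableSet_singleton n)).union
    (measurable_tails hξ N (measurableSet_singleton n))

lemma measurable_andDuration {ξ : ℕ → Ω → ℤ} (hξ : ∀ i, Measurable (ξ i)) (n : ℕ) :
    Measurable (andDuration ξ n) :=
  measurable_sInf_nat fun N => (measurable_heads hξ N measurableSet_Ici).inter
    (measurable_tails hξ N measurableSet_Ici)

variable {P : Measure Ω} [IsProbabilityMeasure P] {ξ : ℕ → Ω → ℤ}

lemma IsFairTosses.ae_eq_one_or (hξ : IsFairTosses ξ P) :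
    ∀ᵐ ω ∂P, ∀ i, ξ i ω = 1 ∨ ξ i ω = -1 := by
  refine ae_all_iff.2 fun i => ?_
  have h1 : MeasurableSet {ω | ξ i ω = 1} := hξ.measurable i (measurableSet_singleton 1)
  have h2 : MeasurableSet {ω | ξ i ω = -1} := hξ.measurable i (measurableSet_singleton (-1))
  refine (mem_ae_iff_prob_eq_one (h1.union h2)).2 ?_
  rw [measure_union _ h2, hξ.prob_heads, hξ.prob_tails]
  · simp [ENNReal.inv_two_add_inv_two]
  · refine Set.disjoint_left.2 fun ω (ha : ξ i ω = 1) (hb : ξ i ω = -1) => ?_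
    omega

lemma measurable_decide_eq_one : Measurable fun k : ℤ => decide (k = 1) := measurable_from_top

lemma measurable_toBool (hξ : ∀ i, Measurable (ξ i)) : Measurable (toBool ξ) :=
  measurable_pi_iff.2 fun i => measurable_decide_eq_one.comp (hξ (i + 1))

lemma IsFairTosses.map_toBool (hξ : IsFairTosses ξ P) : P.map (toBool ξ) = coinSeq := by
  have hm (i : ℕ) : Measurable fun ω => toBool ξ ω i :=
    measurable_decide_eq_one.comp (hξ.measurable (i + 1))
  have hind : iIndepFun (fun i ω => toBool ξ ω i) P :=
    (hξ.indep.precomp (add_left_injective 1)).comp (fun _ k => decide (k = 1))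
      fun _ => measurable_decide_eq_one
  have hlaw (i : ℕ) : P.map (fun ω => toBool ξ ω i) = coin := by
    have ht : P.map (fun ω => toBool ξ ω i) {true} = 1 / 2 := by
      rw [Measure.map_apply (hm i) (measurableSet_singleton _), ← hξ.prob_heads (i + 1)]
      congr 1
      ext ω
      simp [toBool]
    have hf : P.map (fun ω => toBool ξ ω i) {false} = 1 / 2 := by
      rw [Measure.map_apply (hm i) (measurableSet_singleton _), ← hξ.prob_tails (i + 1)]
      -- `toBool` sends every value other than `1` to `false`, so this event agrees with Tails only
      -- almost surely.
      refine measure_congr ?_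
      filter_upwards [hξ.ae_eq_one_or] with ω hω
      refine propext ?_
      change toBool ξ ω i = false ↔ ξ (i + 1) ω = -1
      rcases hω (i + 1) with h | h <;> simp [toBool, h]
    refine Measure.ext_of_singleton fun b => ?_
    cases b
    · rw [hf, coin_apply]; simp
    · rw [ht, coin_apply]; simp
  have h := hind.map_fun_eq_infinitePi_map hm
  simp only [hlaw] at h
  exact h

/-- The characteristic function of `(X + Y - 4n) / n ^ (1/4)`. -/
lemma IsFairTosses.charFun_duration (hξ : IsFairTosses ξ P) (n : ℕ) (t : ℝ) :
    charFun (P.map fun ω => ((orDuration ξ n ω : ℝ) + (andDuration ξ n ω : ℝ) - 4 * n) /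
      (n : ℝ) ^ (1 / 4 : ℝ)) t =
      ∫ x, multiplier (t / (n : ℝ) ^ (1 / 4 : ℝ)) ^ excess n n x ∂coinSeq := by
  set s : ℝ := t / (n : ℝ) ^ (1 / 4 : ℝ) with hs
  set z : ℂ := Complex.exp (s * Complex.I) with hz
  have hz0 : z ≠ 0 := Complex.exp_ne_zero _
  have hm : Measurable fun ω => ((orDuration ξ n ω : ℝ) + (andDuration ξ n ω : ℝ) - 4 * n) /
      (n : ℝ) ^ (1 / 4 : ℝ) := by
    have h1 : Measurable fun ω => (orDuration ξ n ω : ℝ) :=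
      measurable_from_top.comp (measurable_orDuration hξ.measurable n)
    have h2 : Measurable fun ω => (andDuration ξ n ω : ℝ) :=
      measurable_from_top.comp (measurable_andDuration hξ.measurable n)
    fun_prop
  have hdone : ∀ᵐ ω ∂P, IsDone n n (toBool ξ ω) :=
    ae_of_ae_map (measurable_toBool hξ.measurable).aemeasurable
      (by rw [hξ.map_toBool]; exact ae_isDone n n)
  rw [charFun_apply_real, integral_map hm.aemeasurable (by fun_prop)]
  calc _ = ∫ ω, (z ^ (4 * n))⁻¹ * weight z n n (toBool ξ ω) ∂P := by
        refine integral_congr_ae ?_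
        filter_upwards [hdone, hξ.ae_eq_one_or] with ω hd hω
        rw [weight, if_pos hd, orDuration_eq hω hd, andDuration_eq hω, hz, ← Complex.exp_nat_mul,
          ← Complex.exp_nat_mul, ← Complex.exp_neg, ← Complex.exp_add, hs]
        congr 1
        push_cast
        ring
    _ = ∫ x, (z ^ (4 * n))⁻¹ * weight z n n x ∂coinSeq := by
        rw [← hξ.map_toBool, integral_map (measurable_toBool hξ.measurable).aemeasurable
          ((measurable_weight z n n).const_mul _).aestronglyMeasurable]
    _ = _ := by
        -- For `a = b = n` the prefactor `z^(2(a+b))` is `z^(4n)` and cancels the centring exactly.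
        rw [integral_const_mul, integral_weight (Complex.norm_exp_ofReal_mul_I s), ← two_mul,
          ← mul_assoc 2 2 n]
        norm_num
        rw [inv_mul_cancel_left₀ (pow_ne_zero _ hz0)]
        rfl

end Tosses

end CoinToss

theorem mainTheorem6 {Ω Ω' : Type*} [MeasurableSpace Ω] [MeasurableSpace Ω']
    (P : Measure Ω) [IsProbabilityMeasure P] (P' : Measure Ω') [IsProbabilityMeasure P']
    (ξ : ℕ → Ω → ℤ) (hξ : CoinToss.IsFairTosses ξ P)
    (Z W : Ω' → ℝ) (hZ : HasLaw Z (gaussianReal 0 1) P') (hW : HasLaw W (gaussianReal 0 1) P')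
    (hZW : IndepFun Z W P') :
    (∀ (n : ℕ) (ω : Ω),
      (((CoinToss.andDuration ξ n ω : ℝ) - 2 * n) - (2 * n - (CoinToss.orDuration ξ n ω : ℝ)))
          / (n : ℝ) ^ (1 / 4 : ℝ) =
        ((CoinToss.orDuration ξ n ω : ℝ) + (CoinToss.andDuration ξ n ω : ℝ) - 4 * n)
          / (n : ℝ) ^ (1 / 4 : ℝ)) ∧
    TendstoInDistribution
      (fun (n : ℕ) (ω : Ω) =>
        ((CoinToss.orDuration ξ n ω : ℝ) + (CoinToss.andDuration ξ n ω : ℝ) - 4 * n)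
          / (n : ℝ) ^ (1 / 4 : ℝ))
      atTop
      (fun ω' : Ω' => (2 : ℝ) ^ (3 / 4 : ℝ) * |Z ω'| ^ (1 / 2 : ℝ) * W ω')
      (fun _ => P) P' := by
  refine ⟨fun n ω => by ring, ?_⟩
  have hZm := hZ.aemeasurable
  have hWm := hW.aemeasurable
  refine ⟨fun n => ?_, by fun_prop, ?_⟩
  · have h1 : Measurable fun ω => (CoinToss.orDuration ξ n ω : ℝ) :=
      measurable_from_top.comp (CoinToss.measurable_orDuration hξ.measurable n)
    have h2 : Measurable fun ω => (CoinToss.andDuration ξ n ω : ℝ) :=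
      measurable_from_top.comp (CoinToss.measurable_andDuration hξ.measurable n)
    exact Measurable.aemeasurable (by fun_prop)
  · refine ProbabilityMeasure.tendsto_iff_tendsto_charFun.2 fun t => ?_
    simp only [ProbabilityMeasure.coe_mk, hξ.charFun_duration,
      CoinToss.charFun_limit hZm hW hZW]
    simpa using (CoinToss.tendsto_integral_pow_multiplier_sub t).add
      (CoinToss.tendsto_integral_exp_pow_excess hZ t)
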